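/- **Theorem 5.11 (viscosity implies generalized).** Let $X$ be a subset of a real Banach space $\mathfrak X$, let $U\subset\mathbb R^m$, let $\Phi:U\to 2^X$ be a set-valued map and $f:X\times U\to\mathbb R$. Write $f_x(u)=f(x,u)$ and, for $u\in U$, $$v(u)=\inf_{x\in\Phi(u)}f(x,u)\in[-\infty,+\infty],\qquad S(u)=\{x\in\Phi(u): f(x,u)=v(u)\}.$$ Let $D_df_x(u)=\lim_{s\downarrow0}\frac{f_x(u+sd)-f_x(u)}{s}$ be the directional derivative, when this limit exists in $\mathbb R$. Let $u_0\in U$ and $d\in\mathbb R^m$. Assume * **(A1)** $f$ is continuous on $X\times U$ and inf-compact on the graph of $\Phi$: for every $u\in U$ there are $\alpha\in\mathbb R$ and a compact $C\subset X$ such that $\emptyset\neq\{x\in\Phi(u'):f(x,u')\le\alpha\}\subset C$ for all $u'\in U$ in a neighborhood of $u$. * **(B) at $u_0$**: either $\Phi(u)=\Phi_0$ for all $u\in U$, with $\Phi_0$ a fixed nonempty relatively closed subset of $X$; or there are a real topological vector space $\mathcal Z$, a continuous $G:X\times U\to\mathcal Z$ and a closed set $K\subset\mathcal Z$ with nonempty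 interior such that $\Phi(u)=\{x\in X:G(x,u)\in K\}$ for all $u\in U$ and $G(x,u_0)\in\operatorname{int}K$ for all $x\in S(u_0)$. * There is an open neighborhood $\mathcal N\subset U$ of $u_0$ such that $D_df_x(u)$ exists for all $(x,u)\in X\times\mathcal N$ and $(x,u)\mapsto D_df_x(u)$ is continuous on $X\times\mathcal N$. Let $w$ be a locally Lipschitz viscosity solution in $\mathcal N$ of $$-\nabla w(u)\cdot d+\inf_{x\in S(u)}D_df_x(u)=0.\qquad(*)$$ That is, for every $u\in\mathcal N$, $-p\cdot d+\inf_{x\in S(u)}D_df_x(u)\le0$ for all $p\in\mathcal J^+w(u)$ and $-p\cdot d+\inf_{x\in S(u)}D_df_x(u)\ge0$ for all $p\in\mathcal J^-w(u)$, where $$\mathcal J^{+}w(u)=\Big\{p\in\mathbb R^m:\limsup_{z\to u}\tfrac{w(z)-w(u)-p\cdot(z-u)}{|z-u|}\le0\Big\},\quad \mathcal J^{-}w(u)=\Big\{p\in\mathbb R^m:\liminf_{z\to u}\tfrac{w(z)-w(u)-p\cdot(z-u)}{|z-u|}\ge0\Big\}.$$ Suppose moreover that $\mathcal J^-w(u_0)\ne\emptyset$.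 Then $w$ is also a Clarke generalized solution of $(*)$ at $u_0$, i.e. (the maximum being attained) $$\max_{p\in\partial w(u_0)}\Big(-p\cdot d+\inf_{x\in S(u_0)}D_df_x(u_0)\Big)=0,$$ where $\partial w(u_0)=\big\{p\in\mathbb R^m: p\cdot y\le \limsup_{u\to u_0,\,h\downarrow0}\tfrac{w(u+hy)-w(u)}{h}\ \text{for all }y\in\mathbb R^m\big\}$. -/

import Mathlib

open Set Filter Topology

/-! ### Directional derivatives -/

section DirectionalDerivative

variable {E : Type*} [NormedAddCommGroup E] [NormedSpace ℝ E]

/-- `φ` is (one-sidedly) directionally differentiable at `u` in the direction `d`: the limit of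
`(φ (u + s d) - φ u) / s` as `s ↓ 0` exists in `ℝ`. -/
def DirDifferentiableAt (φ : E → ℝ) (u d : E) : Prop :=
  DifferentiableWithinAt ℝ (fun s : ℝ => φ (u + s • d)) (Ici 0) 0

/-- The (one-sided) directional derivative `D_d φ (u) = lim_{s ↓ 0} (φ (u + s d) - φ u) / s`. -/
noncomputable def dirDeriv (φ : E → ℝ) (u d : E) : ℝ :=
  derivWithin (fun s : ℝ => φ (u + s • d)) (Ici 0) 0

end DirectionalDerivative

/-! ### The parametric optimization problem `inf_{x ∈ Φ u} f x u` -/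

section Problem

variable {P E : Type*}

/-- The optimal value function `v u = inf_{x ∈ Φ u} f x u`, with values in `[-∞, +∞]`. -/
noncomputable def optimalValue (Φ : E → Set P) (f : P → E → ℝ) (u : E) : EReal :=
  ⨅ x ∈ Φ u, (f x u : EReal)

/-- The optimal set `S u = {x ∈ Φ u : v u = f x u}`. -/
def optimalSet (Φ : E → Set P) (f : P → E → ℝ) (u : E) : Set P :=
  {x | x ∈ Φ u ∧ optimalValue Φ f u = (f x u : EReal)}

/-- Inf-compactness of `f : X × U → ℝ` on the graph of `Φ : U → 2^X`: for every `u ∈ U` there are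
`α ∈ ℝ` and a compact `C ⊆ X` with `∅ ≠ {x ∈ Φ u' : f x u' ≤ α} ⊆ C` for all `u' ∈ U` near `u`. -/
def InfCompactOn [TopologicalSpace P] [TopologicalSpace E]
    (X : Set P) (U : Set E) (Φ : E → Set P) (f : P → E → ℝ) : Prop :=
  ∀ u ∈ U, ∃ (α : ℝ) (C : Set P), IsCompact C ∧ C ⊆ X ∧
    ∀ᶠ u' in 𝓝[U] u, {x | x ∈ Φ u' ∧ f x u' ≤ α}.Nonempty ∧ {x | x ∈ Φ u' ∧ f x u' ≤ α} ⊆ C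

/-- Fixed feasible set: `Φ u` is one and the same nonempty, relatively closed subset of `X` for
all `u ∈ U`. -/
def FixedFeasible [TopologicalSpace P] (X : Set P) (U : Set E) (Φ : E → Set P) : Prop :=
  ∃ Φ₀ : Set P, Φ₀.Nonempty ∧ (∃ A : Set P, IsClosed A ∧ Φ₀ = X ∩ A) ∧ ∀ u ∈ U, Φ u = Φ₀

/-- Perturbed feasible sets `Φ u = {x ∈ X : G x u ∈ K}`, with `G` continuous on `X × U` and `K`
closed with nonempty interior, satisfying the Slater-like condition at `u₀`. -/
structure PerturbedFeasibleAt {Z : Type*} [TopologicalSpace P] [TopologicalSpace E]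
    [TopologicalSpace Z] (X : Set P) (U : Set E) (Φ : E → Set P) (f : P → E → ℝ)
    (G : P → E → Z) (K : Set Z) (u₀ : E) : Prop where
  continuousOn : ContinuousOn (fun q : P × E => G q.1 q.2) (X ×ˢ U)
  isClosed : IsClosed K
  interior_nonempty : (interior K).Nonempty
  feasible_eq : ∀ u ∈ U, Φ u = {x | x ∈ X ∧ G x u ∈ K}
  slater : ∀ x ∈ optimalSet Φ f u₀, G x u₀ ∈ interior K

end Problem

/-! ### Viscosity solutions and Clarke generalized solutions of `F (u, w, ∇w) = 0` -/

section Solutions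

variable {E : Type*} [NormedAddCommGroup E] [InnerProductSpace ℝ E]

/-- The first-order quotient `(w u - w u₀ - p · (u - u₀)) / |u - u₀|`, viewed in `[-∞, +∞]`. -/
noncomputable def jetQuotient (w : E → ℝ) (u₀ p u : E) : EReal :=
  (((w u - w u₀ - inner ℝ p (u - u₀)) / ‖u - u₀‖ : ℝ) : EReal)

/-- The superdifferential `J⁺ w (u₀)` (the dual space is identified with `E`). -/
def superJet (w : E → ℝ) (u₀ : E) : Set E :=
  {p | limsup (jetQuotient w u₀ p) (𝓝[≠] u₀) ≤ 0}

/-- The subdifferential `J⁻ w (u₀)`. -/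
def subJet (w : E → ℝ) (u₀ : E) : Set E :=
  {p | 0 ≤ liminf (jetQuotient w u₀ p) (𝓝[≠] u₀)}

/-- `w ∈ USC(V)` is a viscosity subsolution of `F (u, w, ∇w) = 0` at `u₀`. -/
def IsViscositySubsolutionAt (F : E → ℝ → E → ℝ) (V : Set E) (w : E → ℝ) (u₀ : E) : Prop :=
  UpperSemicontinuousOn w V ∧ ∀ p ∈ superJet w u₀, F u₀ (w u₀) p ≤ 0

/-- `w ∈ LSC(V)` is a viscosity supersolution of `F (u, w, ∇w) = 0` at `u₀`. -/
def IsViscositySupersolutionAt (F : E → ℝ → E → ℝ) (V : Set E) (w : E → ℝ) (u₀ : E) : Prop :=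
  LowerSemicontinuousOn w V ∧ ∀ p ∈ subJet w u₀, 0 ≤ F u₀ (w u₀) p

/-- `w` is a viscosity solution of `F (u, w, ∇w) = 0` in the open set `V`. -/
def IsViscositySolutionIn (F : E → ℝ → E → ℝ) (V : Set E) (w : E → ℝ) : Prop :=
  ∀ u ∈ V, IsViscositySubsolutionAt F V w u ∧ IsViscositySupersolutionAt F V w u

/-- Clarke's generalized directional derivative
`D⁰ w (u₀) y = limsup_{u → u₀, h ↓ 0} (w (u + h y) - w u) / h`, with values in `[-∞, +∞]`
(it is finite when `w` is Lipschitz near `u₀`). -/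
noncomputable def clarkeDeriv (w : E → ℝ) (u₀ y : E) : EReal :=
  limsup (fun q : E × ℝ => (((w (q.1 + q.2 • y) - w q.1) / q.2 : ℝ) : EReal))
    (𝓝 u₀ ×ˢ 𝓝[>] (0 : ℝ))

/-- Clarke's generalized gradient `∂w (u₀)`. -/
def clarkeGradient (w : E → ℝ) (u₀ : E) : Set E :=
  {p | ∀ y : E, ((inner ℝ p y : ℝ) : EReal) ≤ clarkeDeriv w u₀ y}

/-- The function `w`, locally Lipschitz in the open set `V`, is a Clarke generalized solution of
`F (u, w, ∇w) = 0` at `u₀`: `max_{p ∈ ∂w(u₀)} F (u₀, w u₀, p) = 0`. -/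
def IsGeneralizedSolutionAt (F : E → ℝ → E → ℝ) (V : Set E) (w : E → ℝ) (u₀ : E) : Prop :=
  LocallyLipschitzOn V w ∧ IsGreatest ((fun p => F u₀ (w u₀) p) '' clarkeGradient w u₀) 0

/-- The operator `F (u, r, p) = - p · d + inf_{x ∈ S u} D_d f_x (u)`. -/
noncomputable def valueOperator {P : Type*} (Φ : E → Set P) (f : P → E → ℝ) (d : E) :
    E → ℝ → E → ℝ :=
  fun u _ p => - inner ℝ p d + sInf ((fun x => dirDeriv (f x) u d) '' optimalSet Φ f u)

end Solutions

/-!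
Write `g u = inf_{x ∈ S u} D_d f_x (u)`, so that the equation reads `- p · d + g u = 0`. The claim
is that `p ↦ p · d` attains its minimum over `∂w(u₀)`, and that this minimum is `g u₀`.

*Attainment.* A point `p₀` of `J⁻ w (u₀)` lies in `∂w(u₀)` (`subJet_subset_clarkeGradient`), and
the supersolution property gives `p₀ · d ≤ g u₀`. So it is enough to show `g u₀ ≤ p · d` for all
`p ∈ ∂w(u₀)`.

*Lower bound.* Inf-compactness and condition (B) make the optimal sets compact and outer
semicontinuous at `u₀` (`exists_subseq_tendsto_optimalSet`), so `g` is lower semicontinuous at `u₀`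
(`eventually_le_sInf_dirDeriv`). Hence, given `c < g u₀`, the subsolution property says that
`c ≤ p · d` for all `p ∈ J⁺ w (u)` and all `u` near `u₀`. This differential inequality integrates to
`w u + h c ≤ w (u + h d)` (`le_sub_of_superJet`), hence `D⁰ w (u₀) (-d) ≤ -c`, which bounds `p · d`
from below by `c` on `∂w(u₀)`.

The integration does not need Rademacher's theorem. The sup-convolution
`m y = max_z (w z - M |z - y|²)` has at each maximizer `z` the supergradient
`2 M (z - y) ∈ J⁺ w (z)`, so one step along `d` gives `m (y + s d) ≥ m y + s c - M s² |d|²`. Adding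
`n` steps of length `h / n`, letting `n → ∞` and then `M → ∞`, yields the inequality for `w`.
-/

/-! ### Optimal sets -/

section OptimalSets

variable {P E : Type*}

theorem mem_optimalSet_iff {Φ : E → Set P} {f : P → E → ℝ} {u : E} {x : P} :
    x ∈ optimalSet Φ f u ↔ x ∈ Φ u ∧ ∀ y ∈ Φ u, f x u ≤ f y u := by
  refine ⟨fun ⟨hx, hv⟩ => ⟨hx, fun y hy => ?_⟩, fun ⟨hx, h⟩ => ⟨hx, le_antisymm ?_ ?_⟩⟩
  · have : optimalValue Φ f u ≤ (f y u : EReal) := iInf₂_le y hy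
    rw [hv] at this
    exact EReal.coe_le_coe_iff.1 this
  · exact iInf₂_le x hx
  · exact le_iInf₂ fun y hy => EReal.coe_le_coe_iff.2 (h y hy)

variable [TopologicalSpace P] [TopologicalSpace E]

/-- The graph of `Φ` is sequentially closed relative to `X × U`. -/
def SeqClosedGraphOn (X : Set P) (U : Set E) (Φ : E → Set P) : Prop :=
  ∀ (u : ℕ → E) (x : ℕ → P) (a : E) (b : P), (∀ n, u n ∈ U) → a ∈ U → (∀ n, x n ∈ Φ (u n)) →
    b ∈ X → Tendsto u atTop (𝓝 a) → Tendsto x atTop (𝓝 b) → b ∈ Φ a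

theorem FixedFeasible.seqClosedGraphOn {X : Set P} {U : Set E} {Φ : E → Set P}
    (h : FixedFeasible X U Φ) : SeqClosedGraphOn X U Φ := by
  obtain ⟨Φ₀, -, ⟨A, hA, rfl⟩, hΦ⟩ := h
  intro u x a b hu ha hx hb _ hxb
  rw [hΦ a ha]
  refine ⟨hb, hA.mem_of_tendsto hxb (Eventually.of_forall fun n => ?_)⟩
  have := hx n
  rw [hΦ _ (hu n)] at this
  exact this.2

theorem PerturbedFeasibleAt.seqClosedGraphOn {Z : Type*} [TopologicalSpace Z] {X : Set P}
    {U : Set E} {Φ : E → Set P} {f : P → E → ℝ} {G : P → E → Z} {K : Set Z} {u₀ : E}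
    (h : PerturbedFeasibleAt X U Φ f G K u₀) : SeqClosedGraphOn X U Φ := by
  intro u x a b hu ha hx hb hua hxb
  have hx' : ∀ n, x n ∈ X ∧ G (x n) (u n) ∈ K := fun n => by
    have := hx n
    rwa [h.feasible_eq _ (hu n)] at this
  rw [h.feasible_eq a ha]
  have hlim : Tendsto (fun n => (x n, u n)) atTop (𝓝[X ×ˢ U] (b, a)) :=
    tendsto_nhdsWithin_iff.2
      ⟨hxb.prodMk_nhds hua, Eventually.of_forall fun n => ⟨(hx' n).1, hu n⟩⟩
  exact ⟨hb, h.isClosed.mem_of_tendsto ((h.continuousOn (b, a) ⟨hb, ha⟩).tendsto.comp hlim)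
    (Eventually.of_forall fun n => (hx' n).2)⟩

/-- Under the Slater-like condition, a minimizer at `u₀` stays feasible for nearby parameters. -/
theorem PerturbedFeasibleAt.eventually_mem {Z : Type*} [TopologicalSpace Z] {X : Set P}
    {U : Set E} {Φ : E → Set P} {f : P → E → ℝ} {G : P → E → Z} {K : Set Z} {u₀ : E}
    (h : PerturbedFeasibleAt X U Φ f G K u₀) (hu₀ : u₀ ∈ U) {x : P}
    (hx : x ∈ optimalSet Φ f u₀) : ∀ᶠ u in 𝓝[U] u₀, x ∈ Φ u := by
  have hxX : x ∈ X := by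
    have := hx.1
    rw [h.feasible_eq _ hu₀] at this
    exact this.1
  have hlim : Tendsto (fun u => (x, u)) (𝓝[U] u₀) (𝓝[X ×ˢ U] (x, u₀)) :=
    tendsto_nhdsWithin_iff.2
      ⟨tendsto_const_nhds.prodMk_nhds (tendsto_id.mono_left nhdsWithin_le_nhds),
        eventually_mem_nhdsWithin.mono fun u hu => ⟨hxX, hu⟩⟩
  have := ((h.continuousOn (x, u₀) ⟨hxX, hu₀⟩).tendsto.comp hlim).eventually
    (isOpen_interior.mem_nhds (h.slater x hx))
  filter_upwards [this, eventually_mem_nhdsWithin] with u hu huU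
  rw [h.feasible_eq u huU]
  exact ⟨hxX, interior_subset hu⟩

theorem FixedFeasible.eventually_mem {X : Set P} {U : Set E} {Φ : E → Set P}
    (h : FixedFeasible X U Φ) {u₀ : E} (hu₀ : u₀ ∈ U) {x : P} (hx : x ∈ Φ u₀) :
    ∀ᶠ u in 𝓝[U] u₀, x ∈ Φ u := by
  obtain ⟨Φ₀, -, -, hΦ⟩ := h
  filter_upwards [eventually_mem_nhdsWithin] with u hu
  rwa [hΦ u hu, ← hΦ u₀ hu₀]

end OptimalSets

section Stability

variable {P E : Type*} [MetricSpace P] [TopologicalSpace E]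
  {X : Set P} {U : Set E} {Φ : E → Set P} {f : P → E → ℝ}

theorem optimalSet_nonempty (hf : ContinuousOn (fun q : P × E => f q.1 q.2) (X ×ˢ U))
    (hinf : InfCompactOn X U Φ f) (hcl : SeqClosedGraphOn X U Φ) {u : E} (hu : u ∈ U) :
    (optimalSet Φ f u).Nonempty := by
  obtain ⟨α, C, hC, hCX, hev⟩ := hinf u hu
  obtain ⟨hne, hsub⟩ := hev.self_of_nhdsWithin hu
  have hfu : ContinuousOn (fun x => f x u) X :=
    hf.comp (by fun_prop : ContinuousOn (fun x : P => (x, u)) X) fun x hx => ⟨hx, hu⟩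
  have hclosed : IsClosed {x | x ∈ Φ u ∧ f x u ≤ α} := by
    refine IsSeqClosed.isClosed fun x b hx hxb => ?_
    have hbX : b ∈ X := hCX (hC.isClosed.mem_of_tendsto hxb
      (Eventually.of_forall fun n => hsub (hx n)))
    refine ⟨hcl (fun _ => u) x u b (fun _ => hu) hu (fun n => (hx n).1) hbX tendsto_const_nhds hxb,
      ?_⟩
    have hlim : Tendsto x atTop (𝓝[X] b) := tendsto_nhdsWithin_iff.2
      ⟨hxb, Eventually.of_forall fun n => hCX (hsub (hx n))⟩
    exact le_of_tendsto ((hfu b hbX).tendsto.comp hlim) (Eventually.of_forall fun n => (hx n).2)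
  obtain ⟨x, hx, hmin⟩ := (hC.of_isClosed_subset hclosed hsub).exists_isMinOn hne
    (hfu.mono (hsub.trans hCX))
  refine ⟨x, mem_optimalSet_iff.2 ⟨hx.1, fun y hy => ?_⟩⟩
  rcases le_total (f y u) α with h | h
  · exact hmin ⟨hy, h⟩
  · exact hx.2.trans h

/-- Outer semicontinuity of the optimal sets: minimizers at parameters tending to `u₀` subconverge
to a minimizer at `u₀`. -/
theorem exists_subseq_tendsto_optimalSet
    (hf : ContinuousOn (fun q : P × E => f q.1 q.2) (X ×ˢ U))
    (hinf : InfCompactOn X U Φ f) (hcl : SeqClosedGraphOn X U Φ) {u₀ : E} (hu₀ : u₀ ∈ U)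
    (hpers : ∀ x ∈ optimalSet Φ f u₀, ∀ᶠ u in 𝓝[U] u₀, x ∈ Φ u)
    {u : ℕ → E} {x : ℕ → P} (hu : ∀ n, u n ∈ U) (hlim : Tendsto u atTop (𝓝 u₀))
    (hx : ∀ n, x n ∈ optimalSet Φ f (u n)) :
    ∃ b ∈ X, b ∈ optimalSet Φ f u₀ ∧ ∃ φ : ℕ → ℕ, StrictMono φ ∧
      (∀ n, x (φ n) ∈ X) ∧ Tendsto (x ∘ φ) atTop (𝓝 b) := by
  obtain ⟨α, C, hC, hCX, hev⟩ := hinf u₀ hu₀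
  obtain ⟨xb, hxb⟩ := optimalSet_nonempty hf hinf hcl hu₀
  have hlimU : Tendsto u atTop (𝓝[U] u₀) :=
    tendsto_nhdsWithin_iff.2 ⟨hlim, Eventually.of_forall hu⟩
  obtain ⟨k, hk⟩ := eventually_atTop.1 (hlimU.eventually (hev.and (hpers xb hxb)))
  have hxC : ∀ n, x (n + k) ∈ C := fun n => by
    obtain ⟨⟨⟨y, hy, hyα⟩, hsub⟩, -⟩ := hk (n + k) (Nat.le_add_left _ _)
    have := mem_optimalSet_iff.1 (hx (n + k))
    exact hsub ⟨this.1, (this.2 y hy).trans hyα⟩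
  obtain ⟨b, hbC, φ, hφ, hφb⟩ := hC.tendsto_subseq hxC
  have hbX := hCX hbC
  have hmono : StrictMono fun n => φ n + k := fun i j hij => Nat.add_lt_add_right (hφ hij) k
  have hu' : Tendsto (fun n => u (φ n + k)) atTop (𝓝 u₀) := hlim.comp hmono.tendsto_atTop
  have hbΦ : b ∈ Φ u₀ := hcl (fun n => u (φ n + k)) (fun n => x (φ n + k)) u₀ b (fun n => hu _) hu₀
    (fun n => (hx _).1) hbX hu' hφb
  -- Comparison with the fixed competitor `xb`, which is feasible at `u n` for large `n`.
  have hle : f b u₀ ≤ f xb u₀ := by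
    have hxbX : xb ∈ X :=
      let ⟨⟨⟨y, hy, hyα⟩, hsub⟩, _⟩ := (hev.and (hpers xb hxb)).self_of_nhdsWithin hu₀
      hCX (hsub ⟨hxb.1, ((mem_optimalSet_iff.1 hxb).2 y hy).trans hyα⟩)
    have h1 : Tendsto (fun n => f (x (φ n + k)) (u (φ n + k))) atTop (𝓝 (f b u₀)) :=
      (hf (b, u₀) ⟨hbX, hu₀⟩).tendsto.comp (tendsto_nhdsWithin_iff.2
        ⟨hφb.prodMk_nhds hu', Eventually.of_forall fun n => ⟨hCX (hxC _), hu _⟩⟩)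
    have h2 : Tendsto (fun n => f xb (u (φ n + k))) atTop (𝓝 (f xb u₀)) :=
      (hf (xb, u₀) ⟨hxbX, hu₀⟩).tendsto.comp (tendsto_nhdsWithin_iff.2
        ⟨tendsto_const_nhds.prodMk_nhds hu', Eventually.of_forall fun n => ⟨hxbX, hu _⟩⟩)
    exact le_of_tendsto_of_tendsto' h1 h2 fun n =>
      (mem_optimalSet_iff.1 (hx _)).2 xb (hk _ (Nat.le_add_left _ _)).2
  exact ⟨b, hbX, mem_optimalSet_iff.2
    ⟨hbΦ, fun y hy => hle.trans ((mem_optimalSet_iff.1 hxb).2 y hy)⟩,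
    fun n => φ n + k, hmono, fun n => hCX (hxC _), hφb⟩

theorem isCompact_optimalSet (hf : ContinuousOn (fun q : P × E => f q.1 q.2) (X ×ˢ U))
    (hinf : InfCompactOn X U Φ f) (hcl : SeqClosedGraphOn X U Φ) {u₀ : E} (hu₀ : u₀ ∈ U)
    (hpers : ∀ x ∈ optimalSet Φ f u₀, ∀ᶠ u in 𝓝[U] u₀, x ∈ Φ u) :
    IsCompact (optimalSet Φ f u₀) := by
  refine IsSeqCompact.isCompact fun x hx => ?_
  obtain ⟨b, -, hb, φ, hφ, -, hlim⟩ := exists_subseq_tendsto_optimalSet hf hinf hcl hu₀ hpers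
    (u := fun _ => u₀) (fun _ => hu₀) tendsto_const_nhds hx
  exact ⟨b, hb, φ, hφ, hlim⟩

end Stability

/-- Lower semicontinuity at `u₀` of `u ↦ inf_{x ∈ S u} D_d f_x (u)`. -/
theorem eventually_le_sInf_dirDeriv {P E : Type*} [MetricSpace P] [NormedAddCommGroup E]
    [NormedSpace ℝ E] {X : Set P} {U N : Set E} {Φ : E → Set P} {f : P → E → ℝ}
    (hΦ : ∀ u ∈ U, Φ u ⊆ X)
    (hf : ContinuousOn (fun q : P × E => f q.1 q.2) (X ×ˢ U))
    (hinf : InfCompactOn X U Φ f) (hcl : SeqClosedGraphOn X U Φ) {u₀ d : E}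
    (hN : IsOpen N) (hNU : N ⊆ U) (hu₀ : u₀ ∈ N)
    (hpers : ∀ x ∈ optimalSet Φ f u₀, ∀ᶠ u in 𝓝[U] u₀, x ∈ Φ u)
    (hDc : ContinuousOn (fun q : P × E => dirDeriv (f q.1) q.2 d) (X ×ˢ N))
    {c : ℝ} (hc : c < sInf ((fun x => dirDeriv (f x) u₀ d) '' optimalSet Φ f u₀)) :
    ∀ᶠ u in 𝓝 u₀, c ≤ sInf ((fun x => dirDeriv (f x) u d) '' optimalSet Φ f u) := by
  have hbdd : BddBelow ((fun x => dirDeriv (f x) u₀ d) '' optimalSet Φ f u₀) := by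
    refine (isCompact_optimalSet hf hinf hcl (hNU hu₀) hpers).bddBelow_image ?_
    exact hDc.comp (by fun_prop : ContinuousOn (fun x : P => (x, u₀)) (optimalSet Φ f u₀))
      fun x hx => ⟨hΦ u₀ (hNU hu₀) hx.1, hu₀⟩
  suffices h : ∀ᶠ u in 𝓝 u₀, u ∈ N → ∀ x ∈ optimalSet Φ f u, c ≤ dirDeriv (f x) u d by
    filter_upwards [h, hN.mem_nhds hu₀] with u hu huN
    refine le_csInf ((optimalSet_nonempty hf hinf hcl (hNU huN)).image _) ?_
    rintro _ ⟨x, hx, rfl⟩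
    exact hu huN x hx
  by_contra hcon
  obtain ⟨u, hu, hbad⟩ := exists_seq_forall_of_frequently (not_eventually.1 hcon)
  push Not at hbad
  choose huN x hx hlt using hbad
  obtain ⟨b, hbX, hb, φ, hφ, hxX, hlim⟩ := exists_subseq_tendsto_optimalSet hf hinf hcl (hNU hu₀)
    hpers (fun n => hNU (huN n)) hu hx
  have hD : Tendsto (fun n => dirDeriv (f (x (φ n))) (u (φ n)) d) atTop
      (𝓝 (dirDeriv (f b) u₀ d)) :=
    (hDc (b, u₀) ⟨hbX, hu₀⟩).tendsto.comp (tendsto_nhdsWithin_iff.2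
      ⟨hlim.prodMk_nhds (hu.comp hφ.tendsto_atTop),
        Eventually.of_forall fun n => ⟨hxX n, huN _⟩⟩)
  have h1 : dirDeriv (f b) u₀ d ≤ c :=
    le_of_tendsto hD (Eventually.of_forall fun n => (hlt _).le)
  have h2 := csInf_le hbdd ⟨b, hb, rfl⟩
  exact absurd (hc.trans_le (h2.trans h1)) (lt_irrefl _)

/-! ### Jets and the Clarke gradient -/

section Jets

variable {E : Type*} [NormedAddCommGroup E] [InnerProductSpace ℝ E]

theorem subJet_subset_clarkeGradient (w : E → ℝ) (u₀ : E) :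
    subJet w u₀ ⊆ clarkeGradient w u₀ := by
  intro p hp y
  refine EReal.ge_of_forall_gt_iff_ge.1 fun b hb => ?_
  have hb' : b < inner ℝ p y := EReal.coe_lt_coe_iff.1 hb
  -- It is enough to test the `limsup` along the base points `u = u₀`.
  have hlim : Tendsto (fun h : ℝ => (u₀, h)) (𝓝[>] (0 : ℝ)) (𝓝 u₀ ×ˢ 𝓝[>] (0 : ℝ)) :=
    tendsto_const_nhds.prodMk tendsto_id
  suffices h : ∀ᶠ h : ℝ in 𝓝[>] (0 : ℝ), b ≤ (w (u₀ + h • y) - w u₀) / h from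
    le_limsup_of_frequently_le (hlim.frequently (h.frequently.mono fun h hh =>
      EReal.coe_le_coe_iff.2 hh)) (by isBoundedDefault)
  rcases eq_or_ne y 0 with rfl | hy
  · refine Eventually.of_forall fun h => ?_
    simpa using hb'.le
  have hy' : 0 < ‖y‖ := norm_pos_iff.2 hy
  have hε : 0 < (inner ℝ p y - b) / ‖y‖ := div_pos (sub_pos.2 hb') hy'
  have hev : ∀ᶠ u in 𝓝[≠] u₀, ((-((inner ℝ p y - b) / ‖y‖) : ℝ) : EReal) < jetQuotient w u₀ p u :=
    eventually_lt_of_lt_liminf (lt_of_lt_of_le (by exact_mod_cast neg_lt_zero.2 hε) hp)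
  have hray : Tendsto (fun h : ℝ => u₀ + h • y) (𝓝[>] (0 : ℝ)) (𝓝[≠] u₀) := by
    refine tendsto_nhdsWithin_iff.2 ⟨?_, ?_⟩
    · have : Continuous fun h : ℝ => u₀ + h • y := by fun_prop
      simpa using (this.tendsto 0).mono_left nhdsWithin_le_nhds
    · filter_upwards [self_mem_nhdsWithin] with h hh
      simp [hy, (mem_Ioi.1 hh).ne']
  filter_upwards [hray.eventually hev, self_mem_nhdsWithin] with h hq hh
  have hh : 0 < h := hh
  have hq' := EReal.coe_lt_coe_iff.1 hq
  rw [add_sub_cancel_left, norm_smul, Real.norm_of_nonneg hh.le, inner_smul_right,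
    lt_div_iff₀ (by positivity)] at hq'
  rw [le_div_iff₀ hh]
  have : -((inner ℝ p y - b) / ‖y‖) * (h * ‖y‖) = -(inner ℝ p y - b) * h := by
    field_simp
  linarith

/-- A quadratic touching `w` from above at `z₀` contributes its gradient to `J⁺ w (z₀)`. -/
theorem mem_superJet_of_eventually_le {w : E → ℝ} {z₀ p : E} {M : ℝ}
    (h : ∀ᶠ z in 𝓝 z₀, w z ≤ w z₀ + inner ℝ p (z - z₀) + M * ‖z - z₀‖ ^ 2) :
    p ∈ superJet w z₀ := by
  refine EReal.le_of_forall_lt_iff_le.1 fun ε hε => ?_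
  have hε' : 0 < ε := by exact_mod_cast hε
  refine limsup_le_of_le (h := ?_)
  have hsmall : ∀ᶠ z in 𝓝 z₀, M * ‖z - z₀‖ < ε := by
    have : Continuous fun z => M * ‖z - z₀‖ := by fun_prop
    exact (this.tendsto z₀).eventually_lt_const (by simpa using hε')
  filter_upwards [nhdsWithin_le_nhds h, nhdsWithin_le_nhds hsmall, self_mem_nhdsWithin]
    with z hz hzε hne
  have hpos : 0 < ‖z - z₀‖ := norm_pos_iff.2 (sub_ne_zero.2 hne)
  refine EReal.coe_le_coe_iff.2 ((div_le_iff₀ hpos).2 ?_)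
  nlinarith

/-- One step of the sup-convolution along `d`. With `m y = max_z (w z - M |z - y|²)`, it says
`m (y + s d) ≥ m y + s c - M s² |d|²`, the point `z'` being a maximizer for `y + s d`. -/
theorem supConvolution_step {w : E → ℝ} {d y z z' : E} {M c s : ℝ} {B : Set E} (hs : 0 ≤ s)
    (hp : c ≤ inner ℝ ((2 * M) • (z - y)) d) (hz : z ∈ B)
    (hz' : IsMaxOn (fun x => w x - M * ‖x - (y + s • d)‖ ^ 2) B z') :
    w z - M * ‖z - y‖ ^ 2 + s * c - M * s ^ 2 * ‖d‖ ^ 2 ≤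
      w z' - M * ‖z' - (y + s • d)‖ ^ 2 := by
  have h1 : w z - M * ‖z - (y + s • d)‖ ^ 2 ≤ w z' - M * ‖z' - (y + s • d)‖ ^ 2 := hz' hz
  have h2 : ‖z - (y + s • d)‖ ^ 2
      = ‖z - y‖ ^ 2 - 2 * (s * inner ℝ (z - y) d) + s ^ 2 * ‖d‖ ^ 2 := by
    rw [← sub_sub, norm_sub_sq_real, inner_smul_right, norm_smul, mul_pow, Real.norm_eq_abs,
      sq_abs]
  rw [real_inner_smul_left] at hp
  rw [h2] at h1
  nlinarith [mul_le_mul_of_nonneg_left hp hs]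

/-- For Lipschitz `w`, the maximizers in the sup-convolution are `L / M`-close to the centre. -/
theorem norm_sub_le_of_isMaxOn {F : Type*} [NormedAddCommGroup F] {w : F → ℝ} {y z : F} {M : ℝ}
    {L : NNReal} {B : Set F} (hM : 0 < M)
    (hL : LipschitzOnWith L w B) (hy : y ∈ B) (hz : z ∈ B)
    (hmax : IsMaxOn (fun x => w x - M * ‖x - y‖ ^ 2) B z) : ‖z - y‖ ≤ L / M := by
  have h1 : w y - M * ‖y - y‖ ^ 2 ≤ w z - M * ‖z - y‖ ^ 2 := hmax hy
  have h2 : w z - w y ≤ L * ‖z - y‖ := by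
    have := hL.dist_le_mul z hz y hy
    rw [Real.dist_eq, dist_eq_norm] at this
    exact (le_abs_self _).trans this
  rw [le_div_iff₀ hM]
  rcases (norm_nonneg (z - y)).eq_or_lt with h | h
  · rw [← h]; simp
  · rw [sub_self, norm_zero] at h1
    nlinarith

/-- A lower bound for `p · d` over the superdifferentials of a Lipschitz function integrates along
segments in the direction `d`. -/
theorem le_sub_of_superJet [ProperSpace E] {w : E → ℝ} {u₀ a d : E} {c r h : ℝ} {L : NNReal}
    (hr : 0 < r) (hL : LipschitzOnWith L w (Metric.closedBall u₀ r))
    (hjet : ∀ z ∈ Metric.ball u₀ r, ∀ p ∈ superJet w z, c ≤ inner ℝ p d)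
    (hh : 0 ≤ h) (hseg : ∀ t ∈ Icc 0 h, a + t • d ∈ Metric.ball u₀ (r / 2)) :
    h * c ≤ w (a + h • d) - w a := by
  set B := Metric.closedBall u₀ r with hB
  have hmem : ∀ t ∈ Icc 0 h, a + t • d ∈ B := fun t ht =>
    Metric.ball_subset_closedBall (Metric.ball_subset_ball (by linarith) (hseg t ht))
  -- The inequality for the sup-convolution, up to the discretization error.
  have key : ∀ M : ℝ, 0 < M → L / M < r / 2 → h * c ≤ w (a + h • d) - w a + L ^ 2 / M := by
    intro M hM hLM
    have hex : ∀ y, ∃ z ∈ B, IsMaxOn (fun x => w x - M * ‖x - y‖ ^ 2) B z := fun y =>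
      (isCompact_closedBall u₀ r).exists_isMaxOn ⟨u₀, Metric.mem_closedBall_self hr.le⟩
        (hL.continuousOn.sub (by fun_prop))
    choose ζ hζB hζ using hex
    set m : E → ℝ := fun y => w (ζ y) - M * ‖ζ y - y‖ ^ 2 with hm
    have hslope : ∀ t ∈ Icc 0 h,
        c ≤ inner ℝ ((2 * M) • (ζ (a + t • d) - (a + t • d))) d := by
      intro t ht
      set y := a + t • d
      have hclose := norm_sub_le_of_isMaxOn hM hL (hmem t ht) (hζB y) (hζ y)
      have hball : ζ y ∈ Metric.ball u₀ r := by
        have h1 := Metric.mem_ball.1 (hseg t ht)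
        have h2 := dist_triangle (ζ y) y u₀
        rw [dist_eq_norm (ζ y) y] at h2
        exact Metric.mem_ball.2 (by linarith)
      refine hjet _ hball _ (mem_superJet_of_eventually_le (M := M) ?_)
      filter_upwards [Metric.isOpen_ball.mem_nhds hball] with z hz
      have h1 : w z - M * ‖z - y‖ ^ 2 ≤ w (ζ y) - M * ‖ζ y - y‖ ^ 2 :=
        hζ y (Metric.ball_subset_closedBall hz)
      have h2 : ‖z - y‖ ^ 2 = ‖ζ y - y‖ ^ 2 + 2 * inner ℝ (ζ y - y) (z - ζ y) + ‖z - ζ y‖ ^ 2 := by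
        rw [← norm_add_sq_real]
        congr 2
        abel
      rw [h2] at h1
      rw [real_inner_smul_left]
      linarith
    have hsteps : ∀ n : ℕ, 0 < n → m a + h * c - M * h ^ 2 * ‖d‖ ^ 2 / n ≤ m (a + h • d) := by
      intro n hn
      have hn' : (0 : ℝ) < n := Nat.cast_pos.2 hn
      have hind : ∀ k : ℕ, k ≤ n →
          m a + k * ((h / n) * c - M * (h / n) ^ 2 * ‖d‖ ^ 2) ≤ m (a + (k * (h / n)) • d) := by
        intro k
        induction k with
        | zero => intro _; simp
        | succ k ih =>
          intro hk
          have ht : (k : ℝ) * (h / n) ∈ Icc 0 h := by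
            refine ⟨by positivity, ?_⟩
            rw [mul_div_assoc', div_le_iff₀ hn', mul_comm]
            exact mul_le_mul_of_nonneg_left (by exact_mod_cast (Nat.le_succ k).trans hk) hh
          have h1 := supConvolution_step (w := w) (s := h / n) (by positivity) (hslope _ ht)
            (hζB _) (hζ (a + ((k : ℝ) * (h / n)) • d + (h / n) • d))
          have h2 : a + ((k : ℝ) * (h / n)) • d + (h / n) • d
              = a + (((k + 1 : ℕ) : ℝ) * (h / n)) • d := by
            rw [add_assoc, ← add_smul]
            congr 2
            push_cast
            ring
          rw [h2] at h1
          have h3 := ih ((Nat.le_succ k).trans hk)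
          simp only [hm] at h3 ⊢
          push_cast at h1 h3 ⊢
          linarith
      have h1 := hind n le_rfl
      have h2 : (n : ℝ) * (h / n) = h := by field_simp
      have h3 : (n : ℝ) * ((h / n) * c - M * (h / n) ^ 2 * ‖d‖ ^ 2)
          = h * c - M * h ^ 2 * ‖d‖ ^ 2 / n := by field_simp
      rw [h2, h3] at h1
      linarith
    have hlim : Tendsto (fun n : ℕ => m a + h * c - M * h ^ 2 * ‖d‖ ^ 2 / n) atTop
        (𝓝 (m a + h * c - 0)) :=
      tendsto_const_nhds.sub (tendsto_const_div_atTop_nhds_zero_nat _)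
    have hm1 : m a + h * c - 0 ≤ m (a + h • d) :=
      le_of_tendsto hlim ((eventually_gt_atTop 0).mono fun n hn => hsteps n hn)
    have ha : w a ≤ m a := by
      have : w a - M * ‖a - a‖ ^ 2 ≤ m a := hζ a (by simpa using hmem 0 ⟨le_rfl, hh⟩)
      simpa using this
    have hb : m (a + h • d) ≤ w (a + h • d) + L ^ 2 / M := by
      have hy := hmem h ⟨hh, le_rfl⟩
      have h1 := norm_sub_le_of_isMaxOn hM hL hy (hζB _) (hζ (a + h • d))
      have h2 := hL.dist_le_mul _ (hζB (a + h • d)) _ hy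
      rw [Real.dist_eq, dist_eq_norm] at h2
      have h3 := (le_abs_self _).trans h2
      have h4 := mul_le_mul_of_nonneg_left h1 L.coe_nonneg
      have h5 : (L : ℝ) * (L / M) = L ^ 2 / M := by ring
      have h6 : 0 ≤ M * ‖ζ (a + h • d) - (a + h • d)‖ ^ 2 := by positivity
      simp only [hm]
      linarith
    linarith
  have hlim : ∀ b : ℝ, Tendsto (fun M : ℝ => b / M) atTop (𝓝 0) := fun b =>
    tendsto_const_nhds.div_atTop tendsto_id
  have hlim' : Tendsto (fun M : ℝ => w (a + h • d) - w a + L ^ 2 / M) atTop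
      (𝓝 (w (a + h • d) - w a + 0)) := tendsto_const_nhds.add (hlim _)
  have := ge_of_tendsto hlim' (b := h * c) (by
    filter_upwards [eventually_gt_atTop 0, (hlim L).eventually_lt_const (half_pos hr)]
      with M hM hLM using key M hM hLM)
  simpa using this

/-- A lower bound for `p · d` over the superdifferentials near `u₀` passes to `∂w(u₀)`. -/
theorem le_inner_of_mem_clarkeGradient [ProperSpace E] {w : E → ℝ} {u₀ d p : E} {c : ℝ}
    {L : NNReal} {V : Set E} (hV : V ∈ 𝓝 u₀) (hL : LipschitzOnWith L w V)
    (hjet : ∀ᶠ z in 𝓝 u₀, ∀ p ∈ superJet w z, c ≤ inner ℝ p d)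
    (hp : p ∈ clarkeGradient w u₀) : c ≤ inner ℝ p d := by
  obtain ⟨r, hr, hrsub⟩ := Metric.nhds_basis_closedBall.mem_iff.1 (inter_mem hV hjet)
  suffices h : clarkeDeriv w u₀ (-d) ≤ ((-c : ℝ) : EReal) by
    have := EReal.coe_le_coe_iff.1 ((hp (-d)).trans h)
    rw [inner_neg_right] at this
    linarith
  refine limsup_le_of_le (h := ?_)
  have hcont : Continuous fun q : E × ℝ => ‖q.1 - u₀‖ + |q.2| * ‖d‖ := by fun_prop
  have hnear : ∀ᶠ q : E × ℝ in 𝓝 u₀ ×ˢ 𝓝[>] (0 : ℝ), ‖q.1 - u₀‖ + |q.2| * ‖d‖ < r / 2 := by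
    have h1 := (hcont.tendsto (u₀, 0)).eventually_lt_const (u := r / 2) (by simpa using hr)
    rw [nhds_prod_eq] at h1
    exact h1.filter_mono (Filter.prod_mono le_rfl nhdsWithin_le_nhds)
  have hpos : ∀ᶠ q : E × ℝ in 𝓝 u₀ ×ˢ 𝓝[>] (0 : ℝ), 0 < q.2 :=
    tendsto_snd.eventually (eventually_mem_nhdsWithin (a := (0 : ℝ)) (s := Ioi 0))
  filter_upwards [hnear, hpos] with ⟨u, h⟩ hq hh
  simp only at hq hh ⊢
  rw [abs_of_pos hh] at hq
  -- The difference quotient in the direction `-d` is read from the starting point `u - h d`.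
  have hmain := le_sub_of_superJet (w := w) (a := u + h • -d) (d := d) (h := h) hr
    (hL.mono fun z hz => (hrsub hz).1)
    (fun z hz => (hrsub (Metric.ball_subset_closedBall hz)).2) hh.le (by
      rintro t ⟨ht0, hth⟩
      rw [Metric.mem_ball, dist_eq_norm]
      have h1 : u + h • -d + t • d - u₀ = (u - u₀) + (t - h) • d := by
        rw [smul_neg, sub_smul]
        abel
      rw [h1]
      refine (norm_add_le _ _).trans_lt (lt_of_le_of_lt ?_ hq)
      rw [norm_smul, Real.norm_eq_abs, abs_sub_comm, abs_of_nonneg (sub_nonneg.2 hth)]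
      gcongr
      linarith)
  rw [smul_neg, neg_add_cancel_right] at hmain
  refine EReal.coe_le_coe_iff.2 ((div_le_iff₀ hh).2 ?_)
  rw [smul_neg]
  linarith

end Jets

/-! ### Viscosity solutions are generalized solutions -/

theorem theorem5p11 {m : ℕ}
    {𝔛 : Type*} [NormedAddCommGroup 𝔛] [NormedSpace ℝ 𝔛] [CompleteSpace 𝔛]
    {Z : Type*} [AddCommGroup Z] [Module ℝ Z] [TopologicalSpace Z] [IsTopologicalAddGroup Z]
    [ContinuousSMul ℝ Z]
    (X : Set 𝔛) (U : Set (EuclideanSpace ℝ (Fin m)))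
    (Φ : EuclideanSpace ℝ (Fin m) → Set 𝔛) (hΦ : ∀ u ∈ U, Φ u ⊆ X)
    (f : 𝔛 → EuclideanSpace ℝ (Fin m) → ℝ)
    -- (A1)
    (hf : ContinuousOn (fun q : 𝔛 × EuclideanSpace ℝ (Fin m) => f q.1 q.2) (X ×ˢ U))
    (hinf : InfCompactOn X U Φ f)
    (u₀ d : EuclideanSpace ℝ (Fin m))
    -- Condition (B) at `u₀`
    (G : 𝔛 → EuclideanSpace ℝ (Fin m) → Z) (K : Set Z)
    (hB : FixedFeasible X U Φ ∨ PerturbedFeasibleAt X U Φ f G K u₀)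
    -- `D_d f` exists and is continuous on `X × N`, where `N` is an open neighborhood of `u₀`
    (N : Set (EuclideanSpace ℝ (Fin m))) (hN : IsOpen N) (hNU : N ⊆ U) (hu₀ : u₀ ∈ N)
    (hD : ∀ x ∈ X, ∀ u ∈ N, DirDifferentiableAt (f x) u d)
    (hDc : ContinuousOn
      (fun q : 𝔛 × EuclideanSpace ℝ (Fin m) => dirDeriv (f q.1) q.2 d) (X ×ˢ N))
    (w : EuclideanSpace ℝ (Fin m) → ℝ) (hw : LocallyLipschitzOn N w)
    (hvisc : IsViscositySolutionIn (valueOperator Φ f d) N w)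
    (hJ : (subJet w u₀).Nonempty) :
    IsGeneralizedSolutionAt (valueOperator Φ f d) N w u₀ := by
  have hU := hNU hu₀
  have hcl : SeqClosedGraphOn X U Φ := hB.elim (·.seqClosedGraphOn) (·.seqClosedGraphOn)
  have hpers : ∀ x ∈ optimalSet Φ f u₀, ∀ᶠ u in 𝓝[U] u₀, x ∈ Φ u := fun x hx =>
    hB.elim (·.eventually_mem hU hx.1) (·.eventually_mem hU hx)
  obtain ⟨L, V, hV, hL⟩ := hw hu₀
  rw [hN.nhdsWithin_eq hu₀] at hV
  have hle : ∀ p ∈ clarkeGradient w u₀, valueOperator Φ f d u₀ (w u₀) p ≤ 0 := by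
    intro p hp
    suffices h : sInf ((fun x => dirDeriv (f x) u₀ d) '' optimalSet Φ f u₀) ≤ inner ℝ p d by
      simp only [valueOperator]
      linarith
    refine le_of_forall_lt fun c hc => ?_
    obtain ⟨c', hcc', hc'⟩ := exists_between hc
    refine hcc'.trans_le (le_inner_of_mem_clarkeGradient hV hL ?_ hp)
    filter_upwards [eventually_le_sInf_dirDeriv hΦ hf hinf hcl hN hNU hu₀ hpers hDc hc',
      hN.mem_nhds hu₀] with u hu huN q hq
    have := (hvisc u huN).1.2 q hq
    simp only [valueOperator] at this
    linarith
  obtain ⟨p₀, hp₀⟩ := hJ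
  have hp₀' := subJet_subset_clarkeGradient w u₀ hp₀
  refine ⟨hw, ⟨p₀, hp₀', le_antisymm (hle p₀ hp₀') ((hvisc u₀ hu₀).2.2 p₀ hp₀)⟩, ?_⟩
  rintro _ ⟨p, hp, rfl⟩
  exact hle p hp
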